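/- Let $\Sigma=(V,E)$ be a finite connected simple graph, let $\mathbb T=\{z\in\mathbb C:|z|=1\}$, and let $\Theta=(\Sigma,\varphi)$ be a $\mathbb T$-gain graph, i.e. $\varphi$ assigns to every oriented edge of $\Sigma$ an element of $\mathbb T$, with $\varphi(\vec e_{kj})=\varphi(\vec e_{jk})^{-1}$. The gain $\varphi(P)$ of a walk $P$ is the product of the gains of its successive oriented edges, and $\Theta$ is *balanced* if every cycle has gain $1$. Let $d$ be the graph distance of $\Sigma$. Let $<$ be any strict total order on $V$, with reverse order $<_r$. For $y<z$ let $\varphi^{\max}_<(y,z)$ (resp. $\varphi^{\min}_<(y,z)$) be the largest (resp. smallest) of the gains $\varphi(P)$ of the shortest paths $P$ from $y$ to $z$, in the lexicographic order on $\mathbb C$ (compare real parts first, then imaginary parts). Put $\varphi^{\max}_<(z,y)=\overline{\varphi^{\max}_<(y,z)}$ and $\varphi^{\min}_<(z,y)=\overline{\varphi^{\min}_<(y,z)}$ for $y<z$, and $\varphi^{\max}_<(y,y)=\varphi^{\min}_<(y,y)=0$. Define $$D^{\max}_<(\Theta)=\big(\varphi^{\max}_<(y,z)\,d(y,z)\big)_{y,z\in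 V},\qquad D^{\min}_<(\Theta)=\big(\varphi^{\min}_<(y,z)\,d(y,z)\big)_{y,z\in V},$$ $$DL^{\max}_<(\Theta)=\mathrm{Tr}(\Sigma)-D^{\max}_<(\Theta),\qquad DL^{\min}_<(\Theta)=\mathrm{Tr}(\Sigma)-D^{\min}_<(\Theta),$$ where $\mathrm{Tr}(\Sigma)$ is the diagonal matrix with entries $\sum_{x'\in V}d(x,x')$, $x\in V$. Let $DL(\Sigma)=\mathrm{Tr}(\Sigma)-(d(y,z))_{y,z\in V}$ be the distance Laplacian of $\Sigma$. If $D^{\max}_<(\Theta)=D^{\max}_{<_r}(\Theta)$ and $D^{\min}_<(\Theta)=D^{\min}_{<_r}(\Theta)$, then $\Theta$ is called *ordering independent*, and one writes $DL^{\max}(\Theta)=DL^{\max}_<(\Theta)$ and $DL^{\min}(\Theta)=DL^{\min}_<(\Theta)$. When $DL^{\max}_<(\Theta)=DL^{\min}_<(\Theta)$, this common matrix is denoted $DL(\Theta)$. Two matrices are *cospectral* if they have the same eigenvalues with the same algebraic multiplicities. **Theorem.** $\Theta$ is balanced if and only if $\Theta$ is ordering independent, $DL^{\max}(\Theta)=DL^{\min}(\Theta)=DL(\Theta)$,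 and $DL(\Theta)$ is cospectral to $DL(\Sigma)$. Ordering independence need not be required separately: $\Theta$ is balanced if and only if $DL^{\max}_<(\Theta)=DL^{\min}_<(\Theta)=DL(\Theta)$ and $DL(\Theta)$ is cospectral to $DL(\Sigma)$. -/

import Mathlib

open scoped ComplexConjugate

noncomputable section

/-- A complex unit gain graph: a simple graph together with a gain function on its
oriented edges (darts) into the circle group, the opposite orientation of an edge
having the inverse gain. -/
structure TGainGraph (V : Type*) where
  graph : SimpleGraph V
  gain : graph.Dart → Circle
  gain_symm : ∀ e : graph.Dart, gain e.symm = (gain e)⁻¹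

namespace TGainGraph

variable {V : Type*}

/-- The gain of a walk: the product of the gains of its oriented edges. -/
def walkGain (Θ : TGainGraph V) {y z : V} (P : Θ.graph.Walk y z) : ℂ :=
  (((P.darts.map Θ.gain).prod : Circle) : ℂ)

/-- A gain graph is balanced if every cycle has gain `1`. -/
def Balanced (Θ : TGainGraph V) : Prop :=
  ∀ (v : V) (C : Θ.graph.Walk v v), C.IsCycle → Θ.walkGain C = 1

/-- The shortest oriented paths from `y` to `z`. -/
def shortestPaths (Θ : TGainGraph V) (y z : V) : Set (Θ.graph.Walk y z) :=
  {P | P.IsPath ∧ P.length = Θ.graph.dist y z}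

/-- The shortest paths whose gain has maximal real part. -/
def maxPaths (Θ : TGainGraph V) (y z : V) : Set (Θ.graph.Walk y z) :=
  {P | P ∈ Θ.shortestPaths y z ∧
    ∀ Q ∈ Θ.shortestPaths y z, (Θ.walkGain Q).re ≤ (Θ.walkGain P).re}

/-- The shortest paths whose gain has minimal real part. -/
def minPaths (Θ : TGainGraph V) (y z : V) : Set (Θ.graph.Walk y z) :=
  {P | P ∈ Θ.shortestPaths y z ∧
    ∀ Q ∈ Θ.shortestPaths y z, (Θ.walkGain P).re ≤ (Θ.walkGain Q).re}

/-- `P` is a shortest path with lexicographically largest gain. -/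
def IsMaxPath (Θ : TGainGraph V) {y z : V} (P : Θ.graph.Walk y z) : Prop :=
  P ∈ Θ.maxPaths y z ∧ ∀ Q ∈ Θ.maxPaths y z, (Θ.walkGain Q).im ≤ (Θ.walkGain P).im

/-- `P` is a shortest path with lexicographically smallest gain. -/
def IsMinPath (Θ : TGainGraph V) {y z : V} (P : Θ.graph.Walk y z) : Prop :=
  P ∈ Θ.minPaths y z ∧ ∀ Q ∈ Θ.minPaths y z, (Θ.walkGain P).im ≤ (Θ.walkGain Q).im

theorem finite_shortestPaths [Finite V] (Θ : TGainGraph V) (y z : V) :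
    (Θ.shortestPaths y z).Finite := by
  classical
  have := Fintype.ofFinite V
  refine (Set.toFinite (Set.range fun P : Θ.graph.Path y z => P.1)).subset ?_
  rintro P ⟨hP, -⟩
  exact ⟨⟨P, hP⟩, rfl⟩

theorem shortestPaths_nonempty (Θ : TGainGraph V) (h : Θ.graph.Connected) (y z : V) :
    (Θ.shortestPaths y z).Nonempty := by
  obtain ⟨P, hP, hl⟩ := h.exists_path_of_dist y z
  exact ⟨P, hP, hl⟩

/-- In a finite connected gain graph a largest shortest path exists. -/
theorem exists_isMaxPath [Finite V] (Θ : TGainGraph V) (h : Θ.graph.Connected) (y z : V) :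
    ∃ P : Θ.graph.Walk y z, Θ.IsMaxPath P := by
  have hf := Θ.finite_shortestPaths y z
  obtain ⟨P, hP, hm⟩ := Set.exists_max_image _ (fun P => (Θ.walkGain P).re) hf
    (Θ.shortestPaths_nonempty h y z)
  obtain ⟨Q, hQ, hn⟩ := Set.exists_max_image (Θ.maxPaths y z) (fun P => (Θ.walkGain P).im)
    (hf.subset fun _ hx => hx.1) ⟨P, hP, hm⟩
  exact ⟨Q, hQ, hn⟩

/-- In a finite connected gain graph a smallest shortest path exists. -/
theorem exists_isMinPath [Finite V] (Θ : TGainGraph V) (h : Θ.graph.Connected) (y z : V) :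
    ∃ P : Θ.graph.Walk y z, Θ.IsMinPath P := by
  have hf := Θ.finite_shortestPaths y z
  obtain ⟨P, hP, hm⟩ := Set.exists_min_image _ (fun P => (Θ.walkGain P).re) hf
    (Θ.shortestPaths_nonempty h y z)
  obtain ⟨Q, hQ, hn⟩ := Set.exists_min_image (Θ.minPaths y z) (fun P => (Θ.walkGain P).im)
    (hf.subset fun _ hx => hx.1) ⟨P, hP, hm⟩
  exact ⟨Q, hQ, hn⟩

open Classical in
/-- The gain of a largest shortest path from `y` to `z`; such a path exists if the graph is
finite and connected, and its gain does not depend on the choice. The value `0` in the other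
case is immaterial. -/
def maxGain (Θ : TGainGraph V) (y z : V) : ℂ :=
  if h : ∃ P : Θ.graph.Walk y z, Θ.IsMaxPath P then Θ.walkGain h.choose else 0

open Classical in
/-- The gain of a smallest shortest path from `y` to `z`. -/
def minGain (Θ : TGainGraph V) (y z : V) : ℂ :=
  if h : ∃ P : Θ.graph.Walk y z, Θ.IsMinPath P then Θ.walkGain h.choose else 0

open Classical in
/-- The maximum auxiliary gain with respect to the vertex ordering `lt`. -/
def auxMax (Θ : TGainGraph V) (lt : V → V → Prop) (y z : V) : ℂ :=
  if lt y z then Θ.maxGain y z else if lt z y then conj (Θ.maxGain z y) else 0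

open Classical in
/-- The minimum auxiliary gain with respect to the vertex ordering `lt`. -/
def auxMin (Θ : TGainGraph V) (lt : V → V → Prop) (y z : V) : ℂ :=
  if lt y z then Θ.minGain y z else if lt z y then conj (Θ.minGain z y) else 0

/-- The gain distance matrix `D^max` with respect to the vertex ordering `lt`. -/
def DMax (Θ : TGainGraph V) (lt : V → V → Prop) : Matrix V V ℂ :=
  Matrix.of fun y z => Θ.auxMax lt y z * (Θ.graph.dist y z : ℂ)

/-- The gain distance matrix `D^min` with respect to the vertex ordering `lt`. -/
def DMin (Θ : TGainGraph V) (lt : V → V → Prop) : Matrix V V ℂ :=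
  Matrix.of fun y z => Θ.auxMin lt y z * (Θ.graph.dist y z : ℂ)

/-- Neither gain distance matrix changes when the vertex ordering is reversed. -/
def OrderingIndependent (Θ : TGainGraph V) (lt : V → V → Prop) : Prop :=
  Θ.DMax lt = Θ.DMax (fun y z => lt z y) ∧ Θ.DMin lt = Θ.DMin (fun y z => lt z y)

end TGainGraph

/-- The transmission matrix: the diagonal matrix of the vertex transmissions
`tr x = ∑ x', d(x, x')`. -/
def transmissionMatrix {V : Type*} [Fintype V] [DecidableEq V] (G : SimpleGraph V) :
    Matrix V V ℂ :=
  Matrix.diagonal fun x => ∑ x' : V, (G.dist x x' : ℂ)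

/-- The distance matrix of a graph. -/
def distanceMatrix {V : Type*} (G : SimpleGraph V) : Matrix V V ℂ :=
  Matrix.of fun y z => (G.dist y z : ℂ)

/-- The distance Laplacian matrix of a graph. -/
def distanceLaplacian {V : Type*} [Fintype V] [DecidableEq V] (G : SimpleGraph V) :
    Matrix V V ℂ :=
  transmissionMatrix G - distanceMatrix G

namespace TGainGraph

/-- The gain distance Laplacian `DL^max` with respect to the vertex ordering `lt`. -/
def DLMax {V : Type*} [Fintype V] [DecidableEq V] (Θ : TGainGraph V) (lt : V → V → Prop) :
    Matrix V V ℂ :=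
  transmissionMatrix Θ.graph - Θ.DMax lt

/-- The gain distance Laplacian `DL^min` with respect to the vertex ordering `lt`. -/
def DLMin {V : Type*} [Fintype V] [DecidableEq V] (Θ : TGainGraph V) (lt : V → V → Prop) :
    Matrix V V ℂ :=
  transmissionMatrix Θ.graph - Θ.DMin lt

end TGainGraph

/-- Two complex matrices are cospectral if they have the same eigenvalues with the same
algebraic multiplicities. -/
def Cospectral {V : Type*} [Fintype V] [DecidableEq V] (A B : Matrix V V ℂ) : Prop :=
  A.charpoly.roots = B.charpoly.roots

end

/-! Balance amounts to having a nonzero potential: `x` with `x u = φ(uv) * x v` along every edge. A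
balanced gain graph has a unimodular one, so all walks from `y` to `z` have gain `x y * conj (x z)`.
Hence max, min and vertex order do not matter, and `DLMax` is the conjugate of the distance
Laplacian by the unitary `diagonal x`. Conversely, the distance Laplacian kills the all-ones vector,
so cospectrality gives `DLMax` a nonzero kernel vector `x`. Then the sum of `d(y,z) * ‖x y - g y z *
x z‖ ^ 2`, with `g` the auxiliary gain, is zero (`eq_mul_of_weighted_sum_eq_zero`). On edges `g` is
the gain itself, so `x` is a potential. -/

namespace TGainGraph

variable {V : Type*} (Θ : TGainGraph V)

@[simp]
theorem walkGain_nil (v : V) : Θ.walkGain (.nil : Θ.graph.Walk v v) = 1 := by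
  simp [walkGain]

@[simp]
theorem walkGain_cons {u v w : V} (h : Θ.graph.Adj u v) (P : Θ.graph.Walk v w) :
    Θ.walkGain (.cons h P) = Θ.gain ⟨(u, v), h⟩ * Θ.walkGain P := by
  simp [walkGain]

@[simp]
theorem walkGain_append {u v w : V} (P : Θ.graph.Walk u v) (Q : Θ.graph.Walk v w) :
    Θ.walkGain (P.append Q) = Θ.walkGain P * Θ.walkGain Q := by
  simp [walkGain]

@[simp]
theorem norm_walkGain {u v : V} (P : Θ.graph.Walk u v) : ‖Θ.walkGain P‖ = 1 :=
  Circle.norm_coe _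

theorem gain_mul_gain_symm {u v : V} (h : Θ.graph.Adj u v) :
    (Θ.gain ⟨(u, v), h⟩ : ℂ) * Θ.gain ⟨(v, u), h.symm⟩ = 1 := by
  have := Θ.gain_symm ⟨(u, v), h⟩
  simp only [SimpleGraph.Dart.symm_mk, Prod.swap_prod_mk] at this
  rw [this, ← Circle.coe_mul, mul_inv_cancel, Circle.coe_one]

/-- A function on the vertices whose quotients along the edges are the gains. -/
def IsPotential (x : V → ℂ) : Prop :=
  ∀ (u v : V) (h : Θ.graph.Adj u v), x u = Θ.gain ⟨(u, v), h⟩ * x v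

variable {Θ}

theorem IsPotential.eq_walkGain_mul {x : V → ℂ} (hx : Θ.IsPotential x) {u v : V}
    (P : Θ.graph.Walk u v) : x u = Θ.walkGain P * x v := by
  induction P with
  | nil => simp
  | cons h P ih => rw [walkGain_cons, mul_assoc, ← ih, ← hx]

/-! ### Balance and potentials -/

theorem IsPotential.balanced {x : V → ℂ} (hx : Θ.IsPotential x) (h0 : x ≠ 0)
    (hconn : Θ.graph.Connected) : Θ.Balanced := by
  intro v C _
  obtain ⟨w, hw⟩ := Function.ne_iff.1 h0
  obtain ⟨P⟩ := hconn.preconnected w v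
  have hv : x v ≠ 0 := fun h => hw (by rw [hx.eq_walkGain_mul P, h, mul_zero, Pi.zero_apply])
  exact mul_right_cancel₀ hv (by rw [← hx.eq_walkGain_mul C, one_mul])

/-- Either `P` is the same edge traversed backwards and the gains cancel, or the closed walk is a
genuine cycle. -/
theorem Balanced.walkGain_cons_of_isPath (hb : Θ.Balanced) {u v : V} (h : Θ.graph.Adj u v)
    {P : Θ.graph.Walk v u} (hP : P.IsPath) : Θ.walkGain (.cons h P) = 1 := by
  by_cases he : s(u, v) ∈ P.edges
  · rw [Sym2.eq_swap] at he
    rw [hP.eq_adj_toWalk_of_mem_edges he]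
    simpa [SimpleGraph.Adj.toWalk] using Θ.gain_mul_gain_symm h
  · exact hb _ _ ((SimpleGraph.Walk.cons_isCycle_iff _ _).2 ⟨hP, he⟩)

theorem Balanced.walkGain_bypass [DecidableEq V] (hb : Θ.Balanced) {u v : V}
    (P : Θ.graph.Walk u v) : Θ.walkGain P.bypass = Θ.walkGain P := by
  induction P with
  | nil => rfl
  | @cons u v w h P ih =>
    rw [walkGain_cons, ← ih]
    simp only [SimpleGraph.Walk.bypass]
    split_ifs with hs
    -- The discarded detour is a path closed up by the edge `h`, so it has gain `1`.
    · have h1 := hb.walkGain_cons_of_isPath h (P.bypass_isPath.takeUntil hs)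
      conv_rhs => rw [← P.bypass.take_spec hs]
      rw [walkGain_append, ← mul_assoc, ← walkGain_cons, h1, one_mul]
    · rw [walkGain_cons]

theorem Balanced.walkGain_eq_one (hb : Θ.Balanced) {v : V} (P : Θ.graph.Walk v v) :
    Θ.walkGain P = 1 := by
  classical
  rw [← hb.walkGain_bypass P, (SimpleGraph.Walk.isPath_iff_nil.1 P.bypass_isPath).eq_nil,
    walkGain_nil]

theorem Balanced.exists_isPotential (hb : Θ.Balanced) (hconn : Θ.graph.Connected) :
    ∃ x : V → ℂ, Θ.IsPotential x ∧ ∀ v, ‖x v‖ = 1 := by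
  obtain ⟨r⟩ := hconn.nonempty
  have P (v : V) : Θ.graph.Walk v r := (hconn.preconnected v r).some
  refine ⟨fun v => Θ.walkGain (P v), fun u v h => ?_, fun v => Θ.norm_walkGain _⟩
  -- Both closed walks end with the same return walk, whose gain cancels.
  have h1 := hb.walkGain_eq_one ((P u).append (P u).reverse)
  have h2 := hb.walkGain_eq_one (.cons h ((P v).append (P u).reverse))
  rw [walkGain_append] at h1
  rw [walkGain_cons, walkGain_append, ← mul_assoc] at h2
  have h3 : Θ.walkGain (P u).reverse ≠ 0 := norm_ne_zero_iff.1 (by simp)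
  exact mul_right_cancel₀ h3 (h1.trans h2.symm)

/-! ### Auxiliary gains -/

theorem exists_maxGain_eq [Finite V] (hconn : Θ.graph.Connected) (y z : V) :
    ∃ P ∈ Θ.shortestPaths y z, Θ.maxGain y z = Θ.walkGain P := by
  have h := Θ.exists_isMaxPath hconn y z
  exact ⟨h.choose, h.choose_spec.1.1, dif_pos h⟩

theorem exists_minGain_eq [Finite V] (hconn : Θ.graph.Connected) (y z : V) :
    ∃ P ∈ Θ.shortestPaths y z, Θ.minGain y z = Θ.walkGain P := by
  have h := Θ.exists_isMinPath hconn y z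
  exact ⟨h.choose, h.choose_spec.1.1, dif_pos h⟩

theorem walkGain_of_mem_shortestPaths_of_adj {y z : V} (h : Θ.graph.Adj y z)
    {P : Θ.graph.Walk y z} (hP : P ∈ Θ.shortestPaths y z) :
    Θ.walkGain P = Θ.gain ⟨(y, z), h⟩ := by
  have hl : P.length = 1 := hP.2.trans (SimpleGraph.dist_eq_one_iff_adj.2 h)
  cases P with
  | nil => simp at hl
  | cons h' Q =>
    cases Q with
    | nil => simp
    | cons _ _ => simp at hl

theorem maxGain_of_adj [Finite V] (hconn : Θ.graph.Connected) {y z : V}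
    (h : Θ.graph.Adj y z) : Θ.maxGain y z = Θ.gain ⟨(y, z), h⟩ := by
  obtain ⟨P, hP, hg⟩ := exists_maxGain_eq hconn y z
  rw [hg, walkGain_of_mem_shortestPaths_of_adj h hP]

theorem auxMax_of_adj [Finite V] (hconn : Θ.graph.Connected) {lt : V → V → Prop}
    [Std.Trichotomous lt] {y z : V} (h : Θ.graph.Adj y z) :
    Θ.auxMax lt y z = Θ.gain ⟨(y, z), h⟩ := by
  unfold auxMax
  split_ifs with h1 h2
  · exact maxGain_of_adj hconn h
  · rw [maxGain_of_adj hconn h.symm, ← Circle.coe_inv_eq_conj, ← Θ.gain_symm]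
    rfl
  · exact absurd (Std.Trichotomous.trichotomous _ _ h1 h2) h.ne

theorem norm_auxMax [Finite V] (hconn : Θ.graph.Connected) {lt : V → V → Prop}
    [Std.Trichotomous lt] {y z : V} (h : y ≠ z) : ‖Θ.auxMax lt y z‖ = 1 := by
  have key (y z : V) : ‖Θ.maxGain y z‖ = 1 := by
    obtain ⟨P, -, hg⟩ := exists_maxGain_eq hconn y z
    rw [hg, norm_walkGain]
  unfold auxMax
  split_ifs with h1 h2
  · exact key y z
  · rw [RCLike.norm_conj, key]
  · exact absurd (Std.Trichotomous.trichotomous _ _ h1 h2) h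

section Potential

variable {x : V → ℂ}

theorem IsPotential.walkGain_eq (hx : Θ.IsPotential x) (hn : ∀ v, ‖x v‖ = 1) {y z : V}
    (P : Θ.graph.Walk y z) : Θ.walkGain P = x y * conj (x z) := by
  rw [hx.eq_walkGain_mul P, mul_assoc, Complex.mul_conj, Complex.normSq_eq_norm_sq, hn]
  simp

theorem IsPotential.maxGain_eq [Finite V] (hx : Θ.IsPotential x) (hn : ∀ v, ‖x v‖ = 1)
    (hconn : Θ.graph.Connected) (y z : V) : Θ.maxGain y z = x y * conj (x z) := by
  obtain ⟨P, -, hg⟩ := exists_maxGain_eq hconn y z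
  rw [hg, hx.walkGain_eq hn]

theorem IsPotential.minGain_eq [Finite V] (hx : Θ.IsPotential x) (hn : ∀ v, ‖x v‖ = 1)
    (hconn : Θ.graph.Connected) (y z : V) : Θ.minGain y z = x y * conj (x z) := by
  obtain ⟨P, -, hg⟩ := exists_minGain_eq hconn y z
  rw [hg, hx.walkGain_eq hn]

theorem IsPotential.DMax_eq [Finite V] (hx : Θ.IsPotential x) (hn : ∀ v, ‖x v‖ = 1)
    (hconn : Θ.graph.Connected) (lt : V → V → Prop) [Std.Trichotomous lt] :
    Θ.DMax lt = .of fun y z => x y * conj (x z) * (Θ.graph.dist y z : ℂ) := by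
  ext y z
  simp only [DMax, auxMax, hx.maxGain_eq hn hconn, Matrix.of_apply]
  split_ifs with h1 h2
  · rfl
  · simp [mul_comm]
  -- Here `y = z`: the default `0` agrees with the formula because the distance is `0`.
  · simp [Std.Trichotomous.trichotomous _ _ h1 h2]

theorem IsPotential.DMin_eq [Finite V] (hx : Θ.IsPotential x) (hn : ∀ v, ‖x v‖ = 1)
    (hconn : Θ.graph.Connected) (lt : V → V → Prop) [Std.Trichotomous lt] :
    Θ.DMin lt = .of fun y z => x y * conj (x z) * (Θ.graph.dist y z : ℂ) := by
  ext y z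
  simp only [DMin, auxMin, hx.minGain_eq hn hconn, Matrix.of_apply]
  split_ifs with h1 h2
  · rfl
  · simp [mul_comm]
  · simp [Std.Trichotomous.trichotomous _ _ h1 h2]

end Potential

section Spectrum

variable [Fintype V] [DecidableEq V]

theorem IsPotential.cospectral_DLMax {x : V → ℂ} (hx : Θ.IsPotential x)
    (hn : ∀ v, ‖x v‖ = 1) (hconn : Θ.graph.Connected) (lt : V → V → Prop)
    [Std.Trichotomous lt] : Cospectral (Θ.DLMax lt) (distanceLaplacian Θ.graph) := by
  have hc (v : V) : x v * conj (x v) = 1 := by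
    rw [Complex.mul_conj, Complex.normSq_eq_norm_sq, hn]
    simp
  have hDL : Θ.DLMax lt = Matrix.diagonal x * distanceLaplacian Θ.graph *
      Matrix.diagonal (fun v => conj (x v)) := by
    ext y z
    rw [Matrix.mul_diagonal, Matrix.diagonal_mul, DLMax, hx.DMax_eq hn hconn]
    simp only [distanceLaplacian, transmissionMatrix, distanceMatrix, Matrix.sub_apply,
      Matrix.of_apply]
    rcases eq_or_ne y z with rfl | h
    · simp only [Matrix.diagonal_apply_eq, SimpleGraph.dist_self]
      linear_combination (-∑ v, (Θ.graph.dist y v : ℂ)) * hc y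
    · rw [Matrix.diagonal_apply_ne _ h]
      ring
  have hinv : Matrix.diagonal (fun v => conj (x v)) * Matrix.diagonal x = 1 := by
    rw [Matrix.diagonal_mul_diagonal, ← Matrix.diagonal_one]
    congr 1
    ext v
    rw [mul_comm, hc]
  rw [Cospectral, hDL, Matrix.charpoly_mul_comm, ← mul_assoc, hinv, one_mul]

end Spectrum

end TGainGraph

/-! ### Kernel vectors of a gain Laplacian -/

section Kernel

variable {V : Type*} [Fintype V]

theorem Matrix.zero_mem_roots_charpoly_iff [DecidableEq V] {K : Type*} [Field K] (A : Matrix V V K) :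
    0 ∈ A.charpoly.roots ↔ ∃ x ≠ 0, A.mulVec x = 0 := by
  rw [Polynomial.mem_roots A.charpoly_monic.ne_zero, Polynomial.IsRoot, Matrix.eval_charpoly,
    map_zero, zero_sub, Matrix.det_neg, Matrix.exists_mulVec_eq_zero_iff]
  simp

theorem distanceLaplacian_mulVec_one [DecidableEq V] (G : SimpleGraph V) :
    (distanceLaplacian G).mulVec 1 = 0 := by
  ext y
  rw [distanceLaplacian, Matrix.sub_mulVec, Pi.sub_apply, transmissionMatrix,
    Matrix.mulVec_diagonal]
  simp [Matrix.mulVec, dotProduct, distanceMatrix]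

/-- A weighted sum of squares vanishes, hence so does each term. Only `‖g y z‖ = 1` and the symmetry
of `w` enter, not that `g` is Hermitian. -/
theorem eq_mul_of_weighted_sum_eq_zero {w : V → V → ℝ} (hw : ∀ y z, 0 ≤ w y z)
    (hsymm : ∀ y z, w y z = w z y) {g : V → V → ℂ} (hg : ∀ y z, w y z ≠ 0 → ‖g y z‖ = 1)
    {x : V → ℂ} (hx : ∀ y, ∑ z, (w y z : ℂ) * (x y - g y z * x z) = 0) {y z : V}
    (hyz : w y z ≠ 0) : x y = g y z * x z := by
  -- From `‖a - b‖ ^ 2 = 2 * re (conj a * (a - b)) + ‖b‖ ^ 2 - ‖a‖ ^ 2`. Summed, the first part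
  -- vanishes by `hx` and the rest by symmetry of `w`.
  have hterm (y z : V) : w y z * ‖x y - g y z * x z‖ ^ 2 =
      2 * (conj (x y) * ((w y z : ℂ) * (x y - g y z * x z))).re
        + (w y z * ‖x z‖ ^ 2 - w y z * ‖x y‖ ^ 2) := by
    by_cases h : w y z = 0
    · simp [h]
    have hgx : ‖x z‖ ^ 2 = ‖g y z * x z‖ ^ 2 := by rw [norm_mul, hg y z h, one_mul]
    rw [hgx]
    generalize g y z * x z = b
    simp only [← Complex.normSq_eq_norm_sq, Complex.normSq_apply, Complex.mul_re,
      Complex.mul_im, Complex.sub_re, Complex.sub_im, Complex.conj_re, Complex.conj_im,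
      Complex.ofReal_re, Complex.ofReal_im]
    ring
  have hzero : ∑ y, ∑ z, w y z * ‖x y - g y z * x z‖ ^ 2 = 0 := by
    simp only [hterm, Finset.sum_add_distrib, ← Finset.mul_sum, ← Complex.re_sum, hx,
      Finset.sum_sub_distrib]
    rw [Finset.sum_comm (f := fun y z => w y z * ‖x z‖ ^ 2)]
    simp [hsymm]
  have hnn (y z : V) : 0 ≤ w y z * ‖x y - g y z * x z‖ ^ 2 := mul_nonneg (hw y z) (sq_nonneg _)
  rw [Finset.sum_eq_zero_iff_of_nonneg fun y _ => Finset.sum_nonneg fun z _ => hnn y z] at hzero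
  have h1 := hzero y (Finset.mem_univ y)
  rw [Finset.sum_eq_zero_iff_of_nonneg fun z _ => hnn y z] at h1
  have h2 := h1 z (Finset.mem_univ z)
  simpa [hyz, sub_eq_zero] using h2

end Kernel

namespace TGainGraph

variable {V : Type*} [Fintype V] [DecidableEq V] {Θ : TGainGraph V}

theorem isPotential_of_DLMax_mulVec_eq_zero (hconn : Θ.graph.Connected) {lt : V → V → Prop}
    [Std.Trichotomous lt] {x : V → ℂ} (hx : (Θ.DLMax lt).mulVec x = 0) : Θ.IsPotential x := by
  intro u v h
  rw [← auxMax_of_adj hconn (lt := lt) h]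
  refine eq_mul_of_weighted_sum_eq_zero (w := fun y z => (Θ.graph.dist y z : ℝ))
    (g := Θ.auxMax lt) (fun y z => Nat.cast_nonneg _)
    (fun y z => by rw [SimpleGraph.dist_comm]) (fun y z hyz => norm_auxMax hconn ?_)
    (fun y => ?_) ?_
  · rintro rfl
    simp at hyz
  · have := congrFun hx y
    rw [DLMax, Matrix.sub_mulVec, Pi.sub_apply, transmissionMatrix, Matrix.mulVec_diagonal] at this
    simp only [Matrix.mulVec, dotProduct, DMax, Matrix.of_apply, Finset.sum_mul,
      ← Finset.sum_sub_distrib, Pi.zero_apply] at this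
    rw [← this]
    exact Finset.sum_congr rfl fun z _ => by push_cast; ring
  · simp [SimpleGraph.dist_eq_one_iff_adj.2 h]

theorem balanced_of_cospectral_DLMax (hconn : Θ.graph.Connected) {lt : V → V → Prop}
    [Std.Trichotomous lt] (h : Cospectral (Θ.DLMax lt) (distanceLaplacian Θ.graph)) :
    Θ.Balanced := by
  have := hconn.nonempty
  have h0 := (Matrix.zero_mem_roots_charpoly_iff _).2
    ⟨1, one_ne_zero, distanceLaplacian_mulVec_one Θ.graph⟩
  rw [← h, Matrix.zero_mem_roots_charpoly_iff] at h0
  obtain ⟨x, hx0, hx⟩ := h0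
  exact (isPotential_of_DLMax_mulVec_eq_zero hconn hx).balanced hx0 hconn

end TGainGraph

theorem mainTheorem2 {V : Type*} [Fintype V] [DecidableEq V] (Θ : TGainGraph V)
    (hconn : Θ.graph.Connected) (lt : V → V → Prop) (hlt : IsStrictTotalOrder V lt) :
    (Θ.Balanced ↔
      Θ.OrderingIndependent lt ∧ Θ.DLMax lt = Θ.DLMin lt ∧
        Cospectral (Θ.DLMax lt) (distanceLaplacian Θ.graph)) ∧
    (Θ.Balanced ↔
      Θ.DLMax lt = Θ.DLMin lt ∧ Cospectral (Θ.DLMax lt) (distanceLaplacian Θ.graph)) := by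
  have htri : Std.Trichotomous (fun y z => lt z y) :=
    ⟨fun y z h1 h2 => Std.Trichotomous.trichotomous (r := lt) y z h2 h1⟩
  have forward (hb : Θ.Balanced) : Θ.OrderingIndependent lt ∧ Θ.DLMax lt = Θ.DLMin lt ∧
      Cospectral (Θ.DLMax lt) (distanceLaplacian Θ.graph) := by
    obtain ⟨x, hx, hn⟩ := hb.exists_isPotential hconn
    refine ⟨⟨?_, ?_⟩, ?_, hx.cospectral_DLMax hn hconn lt⟩
    · rw [hx.DMax_eq hn hconn lt, hx.DMax_eq hn hconn]
    · rw [hx.DMin_eq hn hconn lt, hx.DMin_eq hn hconn]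
    · rw [TGainGraph.DLMax, TGainGraph.DLMin, hx.DMax_eq hn hconn, hx.DMin_eq hn hconn]
  exact ⟨⟨forward, fun h => TGainGraph.balanced_of_cospectral_DLMax hconn h.2.2⟩,
    fun hb => (forward hb).2, fun h => TGainGraph.balanced_of_cospectral_DLMax hconn h.2⟩
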